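/- Setting. Let $\mathcal M=(V,\{A_i\}_{i\in V},P)$ be a finite Markov decision process with nonempty action sets $A_i$ and transition probabilities $P(i,a,j)$, and let $R\subseteq V$ be a set of unsafe states. A policy $\mu$ chooses, as a function of the history $X_0,\dots,X_n$, an action of $A_{X_n}$; $\Pr_s^\mu$ is the law of the walk with $X_0=s$. An end component is a pair $(V',\{A'_i\}_{i\in V'})$ with $V'\ne\emptyset$, $\emptyset\neq A'_i\subseteq A_i$, such that $P(i,a,j)>0$ with $i\in V'$, $a\in A_i'$ implies $j\in V'$, and such that any state of $V'$ can be reached from any other one by positive-probability transitions using actions in the $A'_i$. The accepting maximal end components (AMECs) $(V_m',A_m')$, $m=1,\dots,N$, are the end components that are inclusion-maximal among those with $V'\cap R=\emptyset$. For $S\subseteq V$ the specification is: $R$ is never visited and $S$ is visited infinitely often. The reachability probability $\rho_S(s,\mu)$ is the $\Pr_s^\mu$-probability of reaching an AMEC with $V_m'\cap S\neq\emptyset$ without having visited $R$. With unit costs, the optimal average cost per cycle (ACPC) from $s$ is $$q_s(S)=\inf_\mu\ \limsup_{n\to\infty}\ \mathbf E_s^\mu\!\left[\frac{n+1}{C_S(n)}\right]\in[0,\infty],\qquad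 C_S(n)=1+\#\{1\le t\le n: X_t\in S\}.$$ Let $k\ge N$. Let $\mathcal N_1$ be the family of all $S\subseteq\bigcup_m V_m'$ with $|S\cap V_m'|\le 1$ for all $m$ (the partition matroid on the AMECs), let $\mathcal N_{k-N}=\{S:|S|\le k-N\}$ (the uniform matroid), and let $\mathcal N=\mathcal N_1\vee\mathcal N_{k-N}=\{S_1\cup S_2: S_1\in\mathcal N_1,\ S_2\in\mathcal N_{k-N}\}$. Let $\mathcal F$ be the family of sets $S$ with $|S|\le k$ that maximize the reachability probability among all sets of at most $k$ states, i.e. $\rho_{S'}(s,\mu)\le\rho_S(s,\mu)$ for all $S'$ with $|S'|\le k$, all policies $\mu$ and all initial states $s$. Theorem. 1. $\mathcal N_1$ and $\mathcal N$ are the families of independent sets of matroids on $V$. 2. Every $S\in\mathcal F$ maximizes, from every initial state, the optimal (supremum over policies) probability of meeting the specification, among all sets of at most $k$ states. Conversely, if for every $m$ there is $s\in V_m'$ from which the optimal probability of meeting the specification with $S=V\setminus V_m'$ is less than $1$, then every $S$ with $|S|\le k$ that maximizes this optimal probability from every initial state, among all sets of at most $k$ states, belongs to $\mathcal F$. 3.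 $\mathcal F\subseteq\mathcal N$, and every basis of $\mathcal N$ belongs to $\mathcal F$. 4. For every initial state $s$, the problem of minimizing $q_s(S)$ over $S\in\mathcal F$ is equivalent to the problem of minimizing $q_s(S)$ over $S\in\mathcal N$: the first problem has a solution; the two minimum values agree; a set in $\mathcal F$ solves the first problem if and only if it solves the second; and every solution of the second problem is contained in a basis of $\mathcal N$ that solves the first. -/

import Mathlib

open MeasureTheory ProbabilityTheory
open scoped ENNReal

noncomputable section

/-- A Markov decision process with states `V` and actions `A`: at state `i` the actions in `act i`
are available, and action `a` leads to `j` with probability `P i a j`. A state without a choice is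
a state with a single action. The values `P i a` for `a ∉ act i` are never used. -/
structure MDP (V A : Type*) where
  act : V → Finset A
  act_nonempty : ∀ i, (act i).Nonempty
  P : V → A → PMF V

/-- A control policy: it maps the history `X_0, …, X_n` to an action available at `X_n`. -/
structure MDP.Policy {V A : Type*} (M : MDP V A) where
  toFun : (n : ℕ) → (Finset.Iic n → V) → A
  valid : ∀ n h, toFun n h ∈ M.act (h ⟨n, Finset.mem_Iic.2 le_rfl⟩)

section Law

variable {V A : Type*} [Finite V] [MeasurableSpace V] [DiscreteMeasurableSpace V]

/-- The conditional law of `X_{n+1}` given `X_0, …, X_n` under a policy. -/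
def MDP.stepKernel (M : MDP V A) (μ : M.Policy) (n : ℕ) :
    Kernel (Finset.Iic n → V) V :=
  Kernel.ofFunOfCountable fun h =>
    (M.P (h ⟨n, Finset.mem_Iic.2 le_rfl⟩) (μ.toFun n h)).toMeasure

instance (M : MDP V A) (μ : M.Policy) (n : ℕ) : IsMarkovKernel (M.stepKernel μ n) :=
  ⟨fun h => PMF.toMeasure.isProbabilityMeasure
    (M.P (h ⟨n, Finset.mem_Iic.2 le_rfl⟩) (μ.toFun n h))⟩

/-- The law of the walk `X_0, X_1, …` started at `X_0 = s` under the policy `μ`. -/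
def MDP.law (M : MDP V A) (μ : M.Policy) (s : V) : Measure (ℕ → V) :=
  Kernel.traj (X := fun _ => V) (M.stepKernel μ) 0 (fun _ => s)

end Law

section EndComponents

variable {V A : Type*}

/-- `C = (V', A')` is an end component: `V'` is nonempty, every state of `V'` keeps at least one of
its actions, the kept actions do not lead out of `V'`, and they connect every state of `V'` to every
other one. States outside `V'` carry no actions. -/
structure MDP.IsEndComponent (M : MDP V A) (C : Finset V × (V → Finset A)) : Prop where
  nonempty : C.1.Nonempty
  act_empty : ∀ i ∉ C.1, C.2 i = ∅
  act_nonempty : ∀ i ∈ C.1, (C.2 i).Nonempty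
  act_subset : ∀ i ∈ C.1, C.2 i ⊆ M.act i
  closed : ∀ i ∈ C.1, ∀ a ∈ C.2 i, ∀ j, M.P i a j ≠ 0 → j ∈ C.1
  connected : ∀ i ∈ C.1, ∀ j ∈ C.1,
    Relation.ReflTransGen (fun x y => ∃ a ∈ C.2 x, M.P x a y ≠ 0) i j

/-- The accepting maximal end components (AMECs) for the unsafe set `R`: the end components that
are maximal (for inclusion of states and of actions) among those that avoid `R`. -/
def MDP.amecs (M : MDP V A) (R : Finset V) : Set (Finset V × (V → Finset A)) :=
  {C | Maximal (fun D => M.IsEndComponent D ∧ Disjoint D.1 R) C}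

/-- The number `N` of AMECs. -/
def MDP.numAMEC (M : MDP V A) (R : Finset V) : ℕ := (M.amecs R).ncard

end EndComponents

section Objectives

variable {V A : Type*} [Finite V] [MeasurableSpace V] [DiscreteMeasurableSpace V]

/-- Probability, from `s` and under `μ`, that the walk reaches an AMEC that contains a state of `S`
without having visited `R`. -/
def MDP.reachProb (M : MDP V A) (R S : Finset V) (μ : M.Policy) (s : V) : ℝ≥0∞ :=
  M.law μ s {ω | ∃ t, (∀ r ≤ t, ω r ∉ R) ∧
    ∃ C ∈ M.amecs R, ω t ∈ C.1 ∧ ∃ v ∈ S, v ∈ C.1}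

/-- Probability, from `s` and under `μ`, of the safety and liveness specification: `R` is never
visited and `S` is visited infinitely often. -/
def MDP.specProb (M : MDP V A) (R S : Finset V) (μ : M.Policy) (s : V) : ℝ≥0∞ :=
  M.law μ s {ω | (∀ t, ω t ∉ R) ∧ ∃ᶠ t in Filter.atTop, ω t ∈ S}

/-- The maximal probability, over all policies, of the safety and liveness specification. -/
def MDP.maxSpecProb (M : MDP V A) (R S : Finset V) (s : V) : ℝ≥0∞ :=
  ⨆ μ : M.Policy, M.specProb R S μ s

/-- Among the sets of at most `k` states, `S` maximizes the reachability probability, under every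
policy and from every initial state. -/
def MDP.MaximizesReach (M : MDP V A) (R : Finset V) (k : ℕ) (S : Finset V) : Prop :=
  S.card ≤ k ∧ ∀ S' : Finset V, S'.card ≤ k →
    ∀ (μ : M.Policy) (s : V), M.reachProb R S' μ s ≤ M.reachProb R S μ s

/-- Among the sets of at most `k` states, `S` maximizes the optimal probability of the safety and
liveness specification, from every initial state. -/
def MDP.MaximizesSpec (M : MDP V A) (R : Finset V) (k : ℕ) (S : Finset V) : Prop :=
  S.card ≤ k ∧ ∀ S' : Finset V, S'.card ≤ k →
    ∀ s : V, M.maxSpecProb R S' s ≤ M.maxSpecProb R S s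

/-- The index of the cycle at time `n`: the first cycle begins at time `0`, and each visit to `S`
at a positive time completes a cycle and begins a new one. -/
def cycleCount {V : Type*} [DecidableEq V] (S : Finset V) (ω : ℕ → V) (n : ℕ) : ℕ :=
  1 + ((Finset.Icc 1 n).filter fun t => ω t ∈ S).card

/-- The average cost per cycle from `s` under `μ`, every action having cost `1`. -/
def MDP.acpc [DecidableEq V] (M : MDP V A) (S : Finset V) (μ : M.Policy) (s : V) : ℝ≥0∞ :=
  Filter.limsup (fun n : ℕ =>
    ∫⁻ ω, (∑ _t ∈ Finset.range (n + 1), (1 : ℝ≥0∞)) / (cycleCount S ω n : ℝ≥0∞) ∂M.law μ s)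
    Filter.atTop

/-- `q(S)`: the optimal (minimal over all policies) average cost per cycle from `s`. -/
def MDP.optACPC [DecidableEq V] (M : MDP V A) (s : V) (S : Finset V) : ℝ≥0∞ :=
  ⨅ μ : M.Policy, M.acpc S μ s

end Objectives

section Matroids

variable {V A : Type*}

/-- A family of sets is the family of independent sets of a matroid on all of `V`. -/
def IsMatroidFamily (F : Set (Finset V)) : Prop :=
  ∃ Mat : Matroid V, Mat.E = Set.univ ∧ ∀ S : Finset V, Mat.Indep (S : Set V) ↔ S ∈ F

/-- Independent sets of the uniform matroid of rank `r`. -/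
def uniformFamily (V : Type*) (r : ℕ) : Set (Finset V) := {S | S.card ≤ r}

/-- Independent sets of the partition matroid on the AMECs: at most one state of each AMEC, and no
state outside the AMECs. -/
def MDP.partitionFamily [DecidableEq V] (M : MDP V A) (R : Finset V) : Set (Finset V) :=
  {S | (∀ v ∈ S, ∃ C ∈ M.amecs R, v ∈ C.1) ∧ ∀ C ∈ M.amecs R, (S ∩ C.1).card ≤ 1}

/-- Independent sets of the union of two matroids. -/
def unionFamily [DecidableEq V] (F G : Set (Finset V)) : Set (Finset V) :=
  {S | ∃ S₁ ∈ F, ∃ S₂ ∈ G, S = S₁ ∪ S₂}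

/-- Independent sets of the union of the partition matroid on the AMECs with the uniform matroid of
rank `k - N`, where `N` is the number of AMECs. -/
def MDP.jointFamily [DecidableEq V] (M : MDP V A) (R : Finset V) (k : ℕ) : Set (Finset V) :=
  unionFamily (M.partitionFamily R) (uniformFamily V (k - M.numAMEC R))

end Matroids

/-- `S` solves the problem of minimizing `f` over the family `F`. -/
def IsSolution {V : Type*} (F : Set (Finset V)) (f : Finset V → ℝ≥0∞) (S : Finset V) : Prop :=
  S ∈ F ∧ ∀ T ∈ F, f S ≤ f T

end

/-! Everything reduces to one combinatorial fact: a set of at most `k` states lies in $\mathcal F$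
exactly when it meets every AMEC.

If `S` meets every AMEC, requiring the AMEC reached to contain a state of `S` is no restriction, so
the reachability event is as large as possible on every walk (`maximizesReach_of_forall_exists`). If
`S` misses an AMEC `C`, some policy started in `C` never leaves it. Since AMECs are pairwise
disjoint (`eq_of_mem_amecs`), `S` then has reachability probability 0, whereas a set of `k` or fewer
states meeting all AMECs has probability 1 (`MaximizesReach.exists_mem`). A basis of $\mathcal N$ is
such a set because `N ≤ k`.

On the matroid side, let c(S) be the number of AMECs that `S` meets. Then S ∈ $\mathcal N$ iff |S| ≤
(k - N) + c(S) (`mem_jointFamily_iff`). Augmentation, and the fact that bases meet every AMEC,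
follow by counting: a new state in a missed AMEC raises both sides by one.

For the specification, the states outside `R` and the AMECs contain no end component, so almost
surely the walk visits `R` or an AMEC under any policy (`ae_exists_mem`). Hence the specification is
at most as likely as reaching an AMEC safely. When `S` meets all AMECs this bound is attained: upon
entering an AMEC, switch to a stationary strategy that stays there and keeps returning to `S`
(`exists_policy`). Both almost sure statements come from a rank that drops with probability bounded
below (`law_forall_mem_eq_zero`).

Finally, the cost `q_s` can only decrease when `S` grows (`optACPC_anti`), so extending a set of
$\mathcal N$ to a basis lands in $\mathcal F$ at no extra cost, and the two problems are equivalent.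
-/

namespace MDP

/-! ### End components, disjointness of AMECs, and rankings -/

section Components

variable {V A : Type*}

/-- The union of two end components that share a state is an end component. -/
lemma IsEndComponent.sup [DecidableEq V] [DecidableEq A] {M : MDP V A}
    {C D : Finset V × (V → Finset A)}
    (hC : M.IsEndComponent C) (hD : M.IsEndComponent D) {v : V} (hvC : v ∈ C.1) (hvD : v ∈ D.1) :
    M.IsEndComponent (C ⊔ D) where
  nonempty := ⟨v, by simp [hvC]⟩
  act_empty i hi := by
    simp only [Prod.fst_sup, Finset.sup_eq_union, Finset.mem_union, not_or] at hi
    simp [hC.act_empty i hi.1, hD.act_empty i hi.2]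
  act_nonempty i hi := by
    simp only [Prod.fst_sup, Finset.sup_eq_union, Finset.mem_union] at hi
    simp only [Prod.snd_sup, Pi.sup_apply, Finset.sup_eq_union, Finset.union_nonempty]
    exact hi.imp (hC.act_nonempty i) (hD.act_nonempty i)
  act_subset i _ a ha := by
    simp only [Prod.snd_sup, Pi.sup_apply, Finset.sup_eq_union, Finset.mem_union] at ha
    rcases ha with ha | ha
    · by_cases hi : i ∈ C.1
      · exact hC.act_subset i hi ha
      · simp [hC.act_empty i hi] at ha
    · by_cases hi : i ∈ D.1
      · exact hD.act_subset i hi ha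
      · simp [hD.act_empty i hi] at ha
  closed i _ a ha j hj := by
    simp only [Prod.snd_sup, Pi.sup_apply, Finset.sup_eq_union, Finset.mem_union] at ha
    simp only [Prod.fst_sup, Finset.sup_eq_union, Finset.mem_union]
    rcases ha with ha | ha
    · by_cases hi : i ∈ C.1
      · exact .inl (hC.closed i hi a ha j hj)
      · simp [hC.act_empty i hi] at ha
    · by_cases hi : i ∈ D.1
      · exact .inr (hD.closed i hi a ha j hj)
      · simp [hD.act_empty i hi] at ha
  connected := by
    have hl {i j} (h : Relation.ReflTransGen (fun x y => ∃ a ∈ C.2 x, M.P x a y ≠ 0) i j) :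
        Relation.ReflTransGen (fun x y => ∃ a ∈ (C ⊔ D).2 x, M.P x a y ≠ 0) i j :=
      Relation.ReflTransGen.mono (fun _ _ ⟨a, ha, h⟩ => ⟨a, by simp [ha], h⟩) _ _ h
    have hr {i j} (h : Relation.ReflTransGen (fun x y => ∃ a ∈ D.2 x, M.P x a y ≠ 0) i j) :
        Relation.ReflTransGen (fun x y => ∃ a ∈ (C ⊔ D).2 x, M.P x a y ≠ 0) i j :=
      Relation.ReflTransGen.mono (fun _ _ ⟨a, ha, h⟩ => ⟨a, by simp [ha], h⟩) _ _ h
    intro i hi j hj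
    simp only [Prod.fst_sup, Finset.sup_eq_union, Finset.mem_union] at hi hj
    refine Relation.ReflTransGen.trans (b := v) ?_ ?_
    · exact hi.elim (fun h => hl (hC.connected i h v hvC)) (fun h => hr (hD.connected i h v hvD))
    · exact hj.elim (fun h => hl (hC.connected v hvC j h)) (fun h => hr (hD.connected v hvD j h))

lemma maximal_of_mem_amecs {M : MDP V A} {R : Finset V} {C : Finset V × (V → Finset A)}
    (hC : C ∈ M.amecs R) :
    Maximal (fun D : Finset V × (V → Finset A) => M.IsEndComponent D ∧ Disjoint D.1 R) C :=
  hC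

/-- Two AMECs that share a state are equal. -/
lemma eq_of_mem_amecs {M : MDP V A} {R : Finset V} {C D : Finset V × (V → Finset A)}
    (hC : C ∈ M.amecs R) (hD : D ∈ M.amecs R) {v : V} (hvC : v ∈ C.1) (hvD : v ∈ D.1) :
    C = D := by
  classical
  have hC' := maximal_of_mem_amecs hC
  have hD' := maximal_of_mem_amecs hD
  have h : M.IsEndComponent (C ⊔ D) ∧ Disjoint (C ⊔ D).1 R :=
    ⟨hC'.prop.1.sup hD'.prop.1 hvC hvD, by
      simpa using ⟨hC'.prop.2, hD'.prop.2⟩⟩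
  exact (hC'.eq_of_le h le_sup_left).trans (hD'.eq_of_le h le_sup_right).symm

/-- A nonempty set of states in which every state has an action that does not leave the set
contains an end component. -/
lemma exists_isEndComponent (M : MDP V A) {W : Finset V} (hW : W.Nonempty)
    (hcl : ∀ i ∈ W, ∃ a ∈ M.act i, ∀ j, M.P i a j ≠ 0 → j ∈ W) :
    ∃ D, M.IsEndComponent D ∧ D.1 ⊆ W := by
  classical
  obtain ⟨Z, hZW, hZ⟩ := exists_minimal_le_of_wellFoundedLT
    (fun Z : Finset V => Z.Nonempty ∧ ∀ i ∈ Z, ∃ a ∈ M.act i, ∀ j, M.P i a j ≠ 0 → j ∈ Z)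
    W ⟨hW, hcl⟩
  refine ⟨(Z, fun i => if i ∈ Z then (M.act i).filter (fun a => ∀ j, M.P i a j ≠ 0 → j ∈ Z) else ∅),
    ⟨hZ.prop.1, ?_, ?_, ?_, ?_, ?_⟩, hZW⟩
  · intro i hi
    exact if_neg hi
  · intro i hi
    obtain ⟨a, ha, h⟩ := hZ.prop.2 i hi
    exact ⟨a, by simpa [hi, ha] using h⟩
  · intro i hi
    have : i ∈ Z := hi
    simp [this]
  · intro i hi a ha
    have : i ∈ Z := hi
    simp only [this, if_true, Finset.mem_filter] at ha
    exact ha.2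
  · intro i hi j hj
    set G : V → V → Prop := fun x y => ∃ a ∈ (if x ∈ Z then
      (M.act x).filter (fun a => ∀ j, M.P x a j ≠ 0 → j ∈ Z) else ∅), M.P x a y ≠ 0
    have hsub : Z.filter (fun j => Relation.ReflTransGen G i j) ⊆ Z := Finset.filter_subset _ _
    -- The states of `Z` reachable from `i` are again closed under suitable actions, so minimality
    -- makes them all of `Z`; this is connectedness.
    have hle : Z ⊆ Z.filter (fun j => Relation.ReflTransGen G i j) := by
      refine hZ.le_of_le ⟨⟨i, Finset.mem_filter.2 ⟨hi, .refl⟩⟩, ?_⟩ hsub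
      intro x hx
      obtain ⟨hxZ, hix⟩ := Finset.mem_filter.1 hx
      obtain ⟨a, ha, h⟩ := hZ.prop.2 x hxZ
      refine ⟨a, ha, fun y hy => Finset.mem_filter.2 ⟨h y hy, hix.tail ⟨a, ?_, hy⟩⟩⟩
      simpa [hxZ, ha] using h
    exact (Finset.mem_filter.1 (hle hj)).2

/-- Every end component that avoids `R` is contained in an AMEC. -/
lemma IsEndComponent.exists_mem_amecs [Finite V] [Finite A] {M : MDP V A} {R : Finset V}
    {D : Finset V × (V → Finset A)} (hD : M.IsEndComponent D) (hR : Disjoint D.1 R) :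
    ∃ C ∈ M.amecs R, D ≤ C := by
  obtain ⟨C, hDC, hC⟩ := (Set.toFinite
    {C : Finset V × (V → Finset A) | M.IsEndComponent C ∧ Disjoint C.1 R}).exists_le_maximal
    (a := D) ⟨hD, hR⟩
  exact ⟨C, hC, hDC⟩

lemma amecs_notMem_of_mem {M : MDP V A} {R : Finset V} {C : Finset V × (V → Finset A)}
    (hC : C ∈ M.amecs R) {v : V} (hv : v ∈ C.1) : v ∉ R :=
  Finset.disjoint_left.1 (maximal_of_mem_amecs hC).prop.2 hv

/-- A ranking of the states of `U`: if every nonempty subset of `U` has a state that escapes from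
it, then every state of `U` escapes to states of lower rank. -/
lemma exists_rank [DecidableEq V] (Q : V → Set V → Prop)
    (hQ : ∀ i W W', W' ⊆ W → Q i W → Q i W') (U : Finset V)
    (hU : ∀ W ⊆ U, W.Nonempty → ∃ i ∈ W, Q i W) :
    ∃ r : V → ℕ, (∀ v, 0 < r v ↔ v ∈ U) ∧ ∀ i ∈ U, Q i {j | r i ≤ r j} := by
  induction hn : U.card generalizing U with
  | zero =>
    obtain rfl := Finset.card_eq_zero.1 hn
    exact ⟨fun _ => 0, by simp, by simp⟩
  | succ n ih =>
    obtain ⟨i, hi, hiU⟩ := hU U subset_rfl (Finset.card_pos.1 (by omega))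
    obtain ⟨r, hr, hrQ⟩ := ih (U.erase i)
      (fun W hW => hU W (hW.trans (Finset.erase_subset _ _)))
      (by rw [Finset.card_erase_of_mem hi]; omega)
    have hri : r i = 0 := by
      have := (hr i).not.2 (by simp)
      omega
    -- The state `i` that escapes from all of `U` gets rank 1, and the ranks on `U.erase i` shift up
    -- by one; rank 0 marks the outside of `U`.
    refine ⟨fun v => if v ∈ U then r v + 1 else 0, fun v => by by_cases h : v ∈ U <;> simp [h], ?_⟩
    intro x hx
    by_cases hxi : x = i
    · subst hxi
      refine hQ _ _ _ ?_ hiU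
      intro j hj
      by_contra hjU
      have : j ∉ U := hjU
      simp [hi, this] at hj
    · refine hQ _ _ _ ?_ (hrQ x (Finset.mem_erase.2 ⟨hxi, hx⟩))
      intro j hj
      by_cases hjU : j ∈ U
      · simpa [hx, hjU] using hj
      · simp [hx, hjU] at hj

end Components

/-! ### Elementary closure properties of the set families -/

section Families

variable {V A : Type*} [DecidableEq V]

/-- Makes the partition matroid the case `r = 0` of the union, so that augmentation is proved only
once. -/
lemma unionFamily_uniformFamily_zero (F : Set (Finset V)) :
    unionFamily F (uniformFamily V 0) = F := by
  ext S
  simp [unionFamily, uniformFamily]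

lemma mem_unionFamily_of_subset {M : MDP V A} {R : Finset V} {r : ℕ} {S T : Finset V}
    (hT : T ∈ unionFamily (M.partitionFamily R) (uniformFamily V r)) (h : S ⊆ T) :
    S ∈ unionFamily (M.partitionFamily R) (uniformFamily V r) := by
  obtain ⟨T₁, h₁, T₂, h₂, rfl⟩ := hT
  refine ⟨S ∩ T₁, ⟨fun v hv => h₁.1 v (Finset.mem_inter.1 hv).2, fun C hC => ?_⟩, S ∩ T₂, ?_, ?_⟩
  · exact (Finset.card_le_card (Finset.inter_subset_inter_right Finset.inter_subset_right)).trans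
      (h₁.2 C hC)
  · exact (Finset.card_le_card Finset.inter_subset_right).trans h₂
  · rw [← Finset.inter_union_distrib_left, Finset.inter_eq_left.2 h]

lemma exists_maximal_jointFamily [Finite V] {M : MDP V A} {R : Finset V} {k : ℕ} {S : Finset V}
    (hS : S ∈ M.jointFamily R k) :
    ∃ T, S ⊆ T ∧ Maximal (fun U => U ∈ M.jointFamily R k) T :=
  (Set.toFinite {U | U ∈ M.jointFamily R k}).exists_le_maximal hS

end Families

/-! ### The joint matroid, through the number of AMECs met -/

section Matroids

variable {V A : Type*} [Finite V] [Finite A]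

/-- The AMECs that contain a state of `S`. -/
noncomputable def metAmecs (M : MDP V A) (R S : Finset V) : Finset (Finset V × (V → Finset A)) :=
  (Set.toFinite {C | C ∈ M.amecs R ∧ ∃ v ∈ S, v ∈ C.1}).toFinset

lemma mem_metAmecs {M : MDP V A} {R S : Finset V} {C : Finset V × (V → Finset A)} :
    C ∈ M.metAmecs R S ↔ C ∈ M.amecs R ∧ ∃ v ∈ S, v ∈ C.1 := by
  simp [metAmecs]

lemma metAmecs_mono {M : MDP V A} {R S T : Finset V} (h : S ⊆ T) :
    M.metAmecs R S ⊆ M.metAmecs R T := by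
  intro C hC
  rw [mem_metAmecs] at hC ⊢
  exact ⟨hC.1, hC.2.imp fun v hv => ⟨h hv.1, hv.2⟩⟩

lemma card_metAmecs_le (M : MDP V A) (R S : Finset V) :
    (M.metAmecs R S).card ≤ M.numAMEC R := by
  rw [← Set.ncard_coe_finset]
  exact Set.ncard_le_ncard (fun C hC => (mem_metAmecs.1 hC).1) (Set.toFinite _)

lemma card_metAmecs_eq {M : MDP V A} {R S : Finset V}
    (h : ∀ C ∈ M.amecs R, ∃ v ∈ S, v ∈ C.1) : (M.metAmecs R S).card = M.numAMEC R := by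
  rw [← Set.ncard_coe_finset, numAMEC]
  congr 1
  ext C
  simpa [mem_metAmecs] using h C

lemma card_metAmecs_lt_insert [DecidableEq V] {M : MDP V A} {R S : Finset V}
    {C : Finset V × (V → Finset A)} (hC : C ∈ M.amecs R) (hS : ∀ v ∈ S, v ∉ C.1) {e : V}
    (he : e ∈ C.1) : (M.metAmecs R S).card < (M.metAmecs R (insert e S)).card := by
  refine Finset.card_lt_card ((Finset.ssubset_iff_of_subset
    (metAmecs_mono (Finset.subset_insert e S))).2 ⟨C, ?_, ?_⟩)
  · exact mem_metAmecs.2 ⟨hC, e, Finset.mem_insert_self _ _, he⟩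
  · rintro h
    obtain ⟨-, v, hv, hvC⟩ := mem_metAmecs.1 h
    exact hS v hv hvC

variable [DecidableEq V]

lemma card_le_of_mem_partitionFamily {M : MDP V A} {R S : Finset V}
    (hS : S ∈ M.partitionFamily R) : S.card ≤ (M.metAmecs R S).card := by
  refine Finset.card_le_card_of_forall_subsingleton (fun v C => v ∈ C.1) ?_ ?_
  · intro v hv
    obtain ⟨C, hC, hvC⟩ := hS.1 v hv
    exact ⟨C, mem_metAmecs.2 ⟨hC, v, hv, hvC⟩, hvC⟩
  · intro C hC x hx y hy
    exact Finset.card_le_one.1 (hS.2 C (mem_metAmecs.1 hC).1) x (Finset.mem_inter.2 hx) y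
      (Finset.mem_inter.2 hy)

/-- A set meets the AMECs in an independent set of the partition matroid, one state for each AMEC
it meets. -/
lemma exists_transversal (M : MDP V A) (R S : Finset V) :
    ∃ T ⊆ S, T ∈ M.partitionFamily R ∧ T.card = (M.metAmecs R S).card := by
  choose f hf hfC using fun C : {C // C ∈ M.metAmecs R S} => (mem_metAmecs.1 C.2).2
  refine ⟨Finset.univ.image f, ?_, ⟨?_, ?_⟩, ?_⟩
  · intro v hv
    obtain ⟨C, -, rfl⟩ := Finset.mem_image.1 hv
    exact hf C
  · intro v hv
    obtain ⟨C, -, rfl⟩ := Finset.mem_image.1 hv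
    exact ⟨C, (mem_metAmecs.1 C.2).1, hfC C⟩
  · intro D hD
    have h : ∀ v ∈ Finset.univ.image f ∩ D.1, ∃ C : {C // C ∈ M.metAmecs R S}, C.1 = D ∧ f C = v := by
      intro v hv
      obtain ⟨hv, hvD⟩ := Finset.mem_inter.1 hv
      obtain ⟨C, -, rfl⟩ := Finset.mem_image.1 hv
      exact ⟨C, eq_of_mem_amecs (mem_metAmecs.1 C.2).1 hD (hfC C) hvD, rfl⟩
    refine Finset.card_le_one.2 fun v hv w hw => ?_
    obtain ⟨C, hC, rfl⟩ := h v hv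
    obtain ⟨C', hC', rfl⟩ := h w hw
    rw [Subtype.ext (hC.trans hC'.symm)]
  · rw [Finset.card_image_of_injective, Finset.card_univ, Fintype.card_coe]
    intro C C' h
    exact Subtype.ext (eq_of_mem_amecs (mem_metAmecs.1 C.2).1 (mem_metAmecs.1 C'.2).1 (hfC C)
      (h ▸ hfC C'))

/-- The best splitting puts one state of each AMEC met into the partition part; the remaining states
must fit into the uniform part. -/
lemma mem_unionFamily_iff (M : MDP V A) (R : Finset V) (r : ℕ) (S : Finset V) :
    S ∈ unionFamily (M.partitionFamily R) (uniformFamily V r) ↔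
      S.card ≤ r + (M.metAmecs R S).card := by
  constructor
  · rintro ⟨S₁, h₁, S₂, h₂, rfl⟩
    have h₃ := card_le_of_mem_partitionFamily h₁
    have h₄ := Finset.card_le_card (M.metAmecs_mono (R := R) (Finset.subset_union_left (s₁ := S₁)
      (s₂ := S₂)))
    have h₅ : S₂.card ≤ r := h₂
    have := Finset.card_union_le S₁ S₂
    omega
  · intro h
    obtain ⟨T, hTS, hT, hcard⟩ := M.exists_transversal R S
    refine ⟨T, hT, S \ T, ?_, (Finset.union_sdiff_of_subset hTS).symm⟩
    change (S \ T).card ≤ r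
    rw [Finset.card_sdiff_of_subset hTS]
    omega

lemma mem_jointFamily_iff {M : MDP V A} {R : Finset V} {k : ℕ} {S : Finset V} :
    S ∈ M.jointFamily R k ↔ S.card ≤ (k - M.numAMEC R) + (M.metAmecs R S).card :=
  M.mem_unionFamily_iff R _ S

/-- The union of the partition matroid on the AMECs with a uniform matroid is a matroid. -/
lemma isMatroidFamily_unionFamily (M : MDP V A) (R : Finset V) (r : ℕ) :
    IsMatroidFamily (unionFamily (M.partitionFamily R) (uniformFamily V r)) := by
  have h_empty : ∅ ∈ unionFamily (M.partitionFamily R) (uniformFamily V r) := by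
    rw [mem_unionFamily_iff]
    simp
  have h_aug : ∀ ⦃I J : Finset V⦄, I ∈ unionFamily (M.partitionFamily R) (uniformFamily V r) →
      J ∈ unionFamily (M.partitionFamily R) (uniformFamily V r) → I.card < J.card →
      ∃ e ∈ J, e ∉ I ∧ insert e I ∈ unionFamily (M.partitionFamily R) (uniformFamily V r) := by
    intro I J hI hJ hcard
    simp only [mem_unionFamily_iff] at hI hJ ⊢
    by_cases hlt : I.card < r + (M.metAmecs R I).card
    · obtain ⟨e, heJ, heI⟩ := Finset.exists_mem_notMem_of_card_lt_card hcard
      refine ⟨e, heJ, heI, ?_⟩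
      have := Finset.card_le_card (M.metAmecs_mono (R := R) (Finset.subset_insert e I))
      rw [Finset.card_insert_of_notMem heI]
      omega
    -- Here `I` is tight, so the larger independent set `J` must meet more AMECs; a state of `J` in
    -- an AMEC missed by `I` pays for itself.
    · obtain ⟨C, hCJ, hCI⟩ := Finset.exists_mem_notMem_of_card_lt_card
        (show (M.metAmecs R I).card < (M.metAmecs R J).card by omega)
      obtain ⟨hC, e, heJ, heC⟩ := mem_metAmecs.1 hCJ
      have hI' : ∀ v ∈ I, v ∉ C.1 := fun v hv hvC => hCI (mem_metAmecs.2 ⟨hC, v, hv, hvC⟩)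
      refine ⟨e, heJ, fun heI => hI' e heI heC, ?_⟩
      have := card_metAmecs_lt_insert hC hI' heC
      have := Finset.card_insert_le e I
      omega
  exact ⟨(IndepMatroid.ofFinset Set.univ
    (fun S => S ∈ unionFamily (M.partitionFamily R) (uniformFamily V r)) h_empty
    (fun _ _ => mem_unionFamily_of_subset) h_aug (fun _ _ => Set.subset_univ _)).matroid,
    rfl, fun S => IndepMatroid.ofFinset_indep _ _ h_empty (fun _ _ => mem_unionFamily_of_subset)
      h_aug (fun _ _ => Set.subset_univ _)⟩

lemma isMatroidFamily_partitionFamily (M : MDP V A) (R : Finset V) :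
    IsMatroidFamily (M.partitionFamily R) := by
  simpa only [unionFamily_uniformFamily_zero] using M.isMatroidFamily_unionFamily R 0

/-- A basis of the joint matroid meets every AMEC. -/
lemma exists_mem_of_maximal_jointFamily {M : MDP V A} {R : Finset V} {k : ℕ} {S : Finset V}
    (hS : Maximal (fun T => T ∈ M.jointFamily R k) S) {C : Finset V × (V → Finset A)}
    (hC : C ∈ M.amecs R) : ∃ v ∈ S, v ∈ C.1 := by
  by_contra! h
  obtain ⟨e, he⟩ := (maximal_of_mem_amecs hC).prop.1.nonempty
  have h₁ := mem_jointFamily_iff.1 hS.prop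
  have h₂ := card_metAmecs_lt_insert hC h he
  have h₃ := Finset.card_insert_le e S
  have h₄ : insert e S ∈ M.jointFamily R k := mem_jointFamily_iff.2 (by omega)
  exact h e (hS.le_of_ge h₄ (Finset.subset_insert e S) (Finset.mem_insert_self e S)) he

lemma card_le_of_mem_jointFamily {M : MDP V A} {R : Finset V} {k : ℕ} (hk : M.numAMEC R ≤ k)
    {S : Finset V} (hS : S ∈ M.jointFamily R k) : S.card ≤ k := by
  have h₁ := mem_jointFamily_iff.1 hS
  have h₂ := M.card_metAmecs_le R S
  omega

lemma mem_jointFamily_of_forall_exists {M : MDP V A} {R : Finset V} {k : ℕ} {S : Finset V}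
    (hcard : S.card ≤ k) (h : ∀ C ∈ M.amecs R, ∃ v ∈ S, v ∈ C.1) : S ∈ M.jointFamily R k := by
  rw [mem_jointFamily_iff, card_metAmecs_eq h]
  omega

lemma empty_mem_jointFamily (M : MDP V A) (R : Finset V) (k : ℕ) : ∅ ∈ M.jointFamily R k :=
  mem_jointFamily_iff.2 (by simp)

end Matroids

/-! ### Markov property and cylinder probabilities of the walk -/

section Law

variable {V A : Type*} [Finite V] [MeasurableSpace V] [DiscreteMeasurableSpace V]

instance (M : MDP V A) (μ : M.Policy) (s : V) : IsProbabilityMeasure (M.law μ s) := by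
  unfold law
  infer_instance

lemma measurableSet_frestrictLe_preimage (n : ℕ) (B : Set (Finset.Iic n → V)) :
    MeasurableSet (Preorder.frestrictLe (π := fun _ => V) n ⁻¹' B) :=
  Preorder.measurable_frestrictLe n (.of_discrete)

/-- The walk starts at `s`. -/
lemma ae_law_zero (M : MDP V A) (μ : M.Policy) (s : V) : ∀ᵐ ω ∂M.law μ s, ω 0 = s := by
  have h : (M.law μ s).map (Preorder.frestrictLe 0) = Measure.dirac (fun _ => s) := by
    rw [law, Kernel.traj_map_frestrictLe_apply]
    simp [Kernel.id_apply]
  have h' : ∀ᵐ x ∂(M.law μ s).map (Preorder.frestrictLe (π := fun _ => V) 0),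
      x ⟨0, Finset.mem_Iic.2 le_rfl⟩ = s := by
    rw [h, ae_dirac_iff (.of_discrete)]
  exact ae_of_ae_map (by fun_prop) h'

/-- The Markov property for one step. -/
lemma lintegral_law_succ (M : MDP V A) (μ : M.Policy) (s : V) (n : ℕ)
    (F : (Finset.Iic n → V) → V → ℝ≥0∞) :
    ∫⁻ ω, F (Preorder.frestrictLe n ω) (ω (n + 1)) ∂M.law μ s =
      ∫⁻ ω, ∫⁻ v, F (Preorder.frestrictLe n ω) v
        ∂M.stepKernel μ n (Preorder.frestrictLe n ω) ∂M.law μ s := by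
  have h := Kernel.partialTraj_compProd_eq_map_traj (X := fun _ => V) (κ := M.stepKernel μ)
    (Nat.zero_le n) (x₀ := fun _ => s)
  have hF : Measurable (Function.uncurry F) := .of_discrete
  have hG : Measurable fun x => ∫⁻ v, F x v ∂M.stepKernel μ n x := .of_discrete
  calc _ = ∫⁻ p, Function.uncurry F p ∂(M.law μ s).map
        (fun ω => (Preorder.frestrictLe n ω, ω (n + 1))) :=
        (lintegral_map hF (by fun_prop)).symm
    _ = ∫⁻ x, ∫⁻ v, F x v ∂M.stepKernel μ n x ∂(M.law μ s).map (Preorder.frestrictLe n) := by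
        rw [law, ← h, Measure.lintegral_compProd hF, Kernel.traj_map_frestrictLe_apply]
        rfl
    _ = _ := lintegral_map hG (by fun_prop)

/-- If no state that the chosen action can lead to satisfies `B`, then `B` fails at the next
step. -/
lemma ae_law_succ (M : MDP V A) (μ : M.Policy) (s : V) (n : ℕ)
    (B : (Finset.Iic n → V) → V → Prop)
    (hB : ∀ h v, M.P (h ⟨n, Finset.mem_Iic.2 le_rfl⟩) (μ.toFun n h) v ≠ 0 → B h v) :
    ∀ᵐ ω ∂M.law μ s, B (Preorder.frestrictLe n ω) (ω (n + 1)) := by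
  classical
  have h := M.lintegral_law_succ μ s n (fun h v => if B h v then 0 else 1)
  have h0 : ∀ x, ∫⁻ v, (if B x v then 0 else 1 : ℝ≥0∞) ∂M.stepKernel μ n x = 0 := by
    intro x
    rw [lintegral_eq_zero_iff .of_discrete]
    have : M.stepKernel μ n x = (M.P (x ⟨n, Finset.mem_Iic.2 le_rfl⟩) (μ.toFun n x)).toMeasure := rfl
    rw [this, Filter.EventuallyEq, ae_iff_of_countable]
    intro v hv
    rw [PMF.toMeasure_apply_singleton _ _ (.of_discrete)] at hv
    simp [hB x v hv]
  simp only [h0, lintegral_zero] at h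
  rw [lintegral_eq_zero_iff] at h
  · filter_upwards [h] with ω hω
    by_contra hc
    simp [hc] at hω
  · have hm : Measurable fun ω : ℕ → V => (Preorder.frestrictLe (π := fun _ => V) n ω, ω (n + 1)) :=
      by fun_prop
    exact (Measurable.of_discrete (f := Function.uncurry fun (x : Finset.Iic n → V) v =>
      if B x v then (0 : ℝ≥0∞) else 1)).comp hm

/-- The law of an initial segment of the walk. -/
lemma law_cylinder_succ (M : MDP V A) (μ : M.Policy) (s : V) (n : ℕ) (x : Finset.Iic (n + 1) → V) :
    M.law μ s (Preorder.frestrictLe (n + 1) ⁻¹' {x}) =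
      M.law μ s (Preorder.frestrictLe n ⁻¹' {Preorder.frestrictLe₂ (π := fun _ => V) n.le_succ x}) *
        M.stepKernel μ n (Preorder.frestrictLe₂ (π := fun _ => V) n.le_succ x)
          {x ⟨n + 1, Finset.mem_Iic.2 le_rfl⟩} := by
  classical
  set y := Preorder.frestrictLe₂ (π := fun _ => V) n.le_succ x with hy
  set v := x ⟨n + 1, Finset.mem_Iic.2 le_rfl⟩ with hv
  -- The one-step Markov property, applied to the product of the indicators of the past `y` and of
  -- the next state `v`.
  have h := M.lintegral_law_succ μ s n
    (fun h w => ({y} : Set (Finset.Iic n → V)).indicator 1 h * ({v} : Set V).indicator 1 w)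
  have hx : ∀ ω : ℕ → V, Preorder.frestrictLe (π := fun _ => V) (n + 1) ω = x ↔
      Preorder.frestrictLe (π := fun _ => V) n ω = y ∧ ω (n + 1) = v := by
    intro ω
    refine ⟨?_, ?_⟩
    · rintro rfl
      exact ⟨rfl, rfl⟩
    · rintro ⟨h₁, h₂⟩
      ext ⟨i, hi⟩
      rcases (Finset.mem_Iic.1 hi).lt_or_eq with hlt | rfl
      · exact congrFun h₁ ⟨i, Finset.mem_Iic.2 (Nat.lt_succ_iff.1 hlt)⟩
      · exact h₂
  have hl : ∀ ω : ℕ → V, ({y} : Set (Finset.Iic n → V)).indicator (1 : (Finset.Iic n → V) → ℝ≥0∞)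
      (Preorder.frestrictLe (π := fun _ => V) n ω) * ({v} : Set V).indicator 1 (ω (n + 1)) =
      (Preorder.frestrictLe (π := fun _ => V) (n + 1) ⁻¹' {x}).indicator 1 ω := by
    intro ω
    simp only [Set.indicator_apply, Set.mem_preimage, Set.mem_singleton_iff, hx]
    split_ifs <;> simp_all
  have hr : ∀ ω : ℕ → V, ∫⁻ w, ({y} : Set (Finset.Iic n → V)).indicator (1 : (Finset.Iic n → V) → ℝ≥0∞)
      (Preorder.frestrictLe (π := fun _ => V) n ω) * ({v} : Set V).indicator 1 w
      ∂M.stepKernel μ n (Preorder.frestrictLe n ω) =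
      (Preorder.frestrictLe (π := fun _ => V) n ⁻¹' {y}).indicator
        (fun _ => M.stepKernel μ n y {v}) ω := by
    intro ω
    rw [lintegral_const_mul _ .of_discrete, lintegral_indicator_one .of_discrete]
    by_cases hω : Preorder.frestrictLe (π := fun _ => V) n ω = y <;> simp [hω]
  simp only [hl, hr] at h
  rw [lintegral_indicator_one (measurableSet_frestrictLe_preimage _ _),
    lintegral_indicator_const (measurableSet_frestrictLe_preimage _ _)] at h
  rw [h, mul_comm]

/-- Two policies that agree outside `T` give the same probability to a set of histories that avoid
`T` before their last state. -/
lemma law_congr_of_agree (M : MDP V A) (μ μ' : M.Policy) (s : V) (T : Set V)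
    (hT : ∀ n h, h ⟨n, Finset.mem_Iic.2 le_rfl⟩ ∉ T → μ.toFun n h = μ'.toFun n h)
    (n : ℕ) (B : Set (Finset.Iic n → V)) (hB : ∀ h ∈ B, ∀ i, i.1 < n → h i ∉ T) :
    M.law μ s (Preorder.frestrictLe n ⁻¹' B) = M.law μ' s (Preorder.frestrictLe n ⁻¹' B) := by
  have key : ∀ n, ∀ x : Finset.Iic n → V, (∀ i, i.1 < n → x i ∉ T) →
      M.law μ s (Preorder.frestrictLe n ⁻¹' {x}) = M.law μ' s (Preorder.frestrictLe n ⁻¹' {x}) := by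
    intro n
    induction n with
    | zero =>
      intro x _
      simp only [law]
      rw [← Measure.map_apply (Preorder.measurable_frestrictLe 0) .of_discrete,
        ← Measure.map_apply (Preorder.measurable_frestrictLe 0) .of_discrete,
        Kernel.traj_map_frestrictLe_apply, Kernel.traj_map_frestrictLe_apply]
      simp
    | succ n ih =>
      intro x hx
      rw [law_cylinder_succ, law_cylinder_succ, ih]
      · congr 2
        change (M.P _ (μ.toFun n _)).toMeasure = (M.P _ (μ'.toFun n _)).toMeasure
        rw [hT]
        exact hx _ (Nat.lt_succ_self n)
      · exact fun i hi => hx _ (hi.trans (Nat.lt_succ_self n))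
  have hsum : ∀ ν : M.Policy, M.law ν s (Preorder.frestrictLe n ⁻¹' B) =
      ∑ x ∈ B.toFinite.toFinset, M.law ν s (Preorder.frestrictLe n ⁻¹' {x}) := by
    intro ν
    rw [sum_measure_preimage_singleton]
    · simp
    · exact fun _ _ => measurableSet_frestrictLe_preimage _ _
  rw [hsum, hsum]
  exact Finset.sum_congr rfl fun x hx => key n x (hB x (by simpa using hx))

end Law

/-! ### Geometric decay from a rank that drops with positive probability -/

section Decay

variable {V A : Type*} [MeasurableSpace V] [DiscreteMeasurableSpace V]

/-- If, at the state `x` of positive rank, the rank decreases with probability at least `ε`, then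
the expectation of `1 - ε ^ r` contracts by a factor. -/
lemma lintegral_potential_le (κ : Measure V) [IsProbabilityMeasure κ] (r : V → ℕ) {ε : ℝ}
    (hε : 0 < ε) (hε1 : ε ≤ 1) {K : ℕ} (hK : ∀ v, r v ≤ K) {m : ℕ} (hm : 0 < m) (hmK : m ≤ K)
    (h : ENNReal.ofReal ε ≤ κ {v | r v < m}) :
    ∫⁻ v, ENNReal.ofReal (1 - ε ^ r v) ∂κ ≤
      ENNReal.ofReal (1 - (1 - ε) * ε ^ K) * ENNReal.ofReal (1 - ε ^ m) := by
  obtain ⟨l, rfl⟩ : ∃ l, m = l + 1 := ⟨m - 1, by omega⟩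
  set L : Set V := {v | r v < l + 1}
  set p := κ.real L
  have hp : κ L = ENNReal.ofReal p := (ofReal_measureReal).symm
  have hp1 : p ≤ 1 := measureReal_le_one
  have hpε : ε ≤ p := by
    rw [hp] at h
    exact (ENNReal.ofReal_le_ofReal_iff measureReal_nonneg).1 h
  have hLc : κ Lᶜ = ENNReal.ofReal (1 - p) := by
    rw [← ofReal_measureReal, measureReal_compl .of_discrete, probReal_univ]
  have hKl : ε ^ K ≤ ε ^ l := pow_le_pow_of_le_one hε.le hε1 (by omega)
  have hl1 : ε ^ l ≤ 1 := pow_le_one₀ hε.le hε1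
  have hK0 : 0 < ε ^ K := pow_pos hε K
  calc ∫⁻ v, ENNReal.ofReal (1 - ε ^ r v) ∂κ
      ≤ ∫⁻ v, (L.indicator (fun _ => ENNReal.ofReal (1 - ε ^ l)) v +
          Lᶜ.indicator (fun _ => ENNReal.ofReal (1 - ε ^ K)) v) ∂κ := by
        refine lintegral_mono fun v => ?_
        by_cases hv : v ∈ L
        · have : ε ^ l ≤ ε ^ r v := pow_le_pow_of_le_one hε.le hε1 (Nat.lt_succ_iff.1 hv)
          simp only [hv, Set.indicator_of_mem, Set.mem_compl_iff, not_true_eq_false,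
            not_false_eq_true, Set.indicator_of_notMem, add_zero]
          exact ENNReal.ofReal_le_ofReal (by linarith)
        · have : ε ^ K ≤ ε ^ r v := pow_le_pow_of_le_one hε.le hε1 (hK v)
          simp only [hv, Set.indicator_of_mem, Set.mem_compl_iff,
            not_false_eq_true, Set.indicator_of_notMem, zero_add]
          exact ENNReal.ofReal_le_ofReal (by linarith)
    _ = ENNReal.ofReal ((1 - ε ^ l) * p + (1 - ε ^ K) * (1 - p)) := by
        rw [lintegral_add_left .of_discrete, lintegral_indicator_const .of_discrete,
          lintegral_indicator_const .of_discrete, hp, hLc,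
          ← ENNReal.ofReal_mul (by linarith), ← ENNReal.ofReal_mul (by linarith),
          ← ENNReal.ofReal_add]
        · exact mul_nonneg (by linarith) (hε.le.trans hpε)
        · exact mul_nonneg (by linarith) (by linarith)
    _ ≤ _ := by
        rw [← ENNReal.ofReal_mul (by nlinarith)]
        refine ENNReal.ofReal_le_ofReal ?_
        -- `h1` reduces the bound to the worst case `p = ε`; `h2` is the nonnegative cross term in
        -- the expansion of the product on the right.
        have h1 : 0 ≤ (p - ε) * (ε ^ l - ε ^ K) := mul_nonneg (by linarith) (by linarith)
        have h2 : 0 ≤ (1 - ε) * ε ^ K * ε ^ (l + 1) :=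
          mul_nonneg (mul_nonneg (by linarith) hK0.le) (pow_pos hε _).le
        rw [pow_succ] at h2 ⊢
        nlinarith

/-- If, as long as the history stays in `D`, the rank of the state is positive and decreases with
probability at least `ε` at every step, then almost surely the history does not stay in `D`. -/
lemma law_forall_mem_eq_zero [Finite V] (M : MDP V A) (μ : M.Policy) (s : V) (n₀ : ℕ) (r : V → ℕ)
    {ε : ℝ≥0∞} (hε : ε ≠ 0) (D : ∀ n, Set (Finset.Iic n → V))
    (hD : ∀ n ≥ n₀, ∀ h ∈ D n, 0 < r (h ⟨n, Finset.mem_Iic.2 le_rfl⟩) ∧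
      ε ≤ M.stepKernel μ n h {v | r v < r (h ⟨n, Finset.mem_Iic.2 le_rfl⟩)}) :
    M.law μ s {ω | ∀ n ≥ n₀, Preorder.frestrictLe n ω ∈ D n} = 0 := by
  obtain ⟨K, hK⟩ : ∃ K, ∀ v, r v ≤ K := by
    obtain ⟨K, hK⟩ := (Set.finite_range r).bddAbove
    exact ⟨K, fun v => hK ⟨v, rfl⟩⟩
  -- A real lower bound replaces the possibly infinite `ε`; `δ ≤ 1/2` makes the potential `1 - δ ^
  -- r` at least 1/2 at positive rank, so its decay bounds the probability of `E n`.
  obtain ⟨δ, hδ, hδ2, hδε⟩ : ∃ δ : ℝ, 0 < δ ∧ δ ≤ 1 / 2 ∧ ENNReal.ofReal δ ≤ ε := by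
    refine ⟨(min ε (ENNReal.ofReal (1 / 2))).toReal, ?_, ?_, ?_⟩
    · refine ENNReal.toReal_pos ?_ (ne_top_of_le_ne_top ENNReal.ofReal_ne_top (min_le_right _ _))
      simp [hε]
    · refine ENNReal.toReal_le_of_le_ofReal (by norm_num) (min_le_right _ _)
    · exact ENNReal.ofReal_toReal_le.trans (min_le_left _ _)
  set f : V → ℝ≥0∞ := fun v => ENNReal.ofReal (1 - δ ^ r v) with hf
  set c : ℝ := 1 - (1 - δ) * δ ^ K with hc
  set E : ℕ → Set (ℕ → V) := fun n =>
    {ω | ∀ m, n₀ ≤ m → m ≤ n₀ + n → Preorder.frestrictLe m ω ∈ D m} with hE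
  have hEm : ∀ n, MeasurableSet (E n) := by
    intro n
    simp only [hE, Set.ofPred_forall]
    exact .iInter fun m => .iInter fun _ => .iInter fun _ =>
      measurableSet_frestrictLe_preimage m (D m)
  have hc0 : c < 1 := by
    have : 0 < (1 - δ) * δ ^ K := mul_pos (by linarith) (pow_pos hδ K)
    rw [hc]; linarith
  have hfE : ∀ n, Measurable fun ω : ℕ → V => f (ω n) := fun n =>
    (Measurable.of_discrete (f := f)).comp (measurable_pi_apply n)
  have hstep : ∀ n, ∫⁻ ω in E (n + 1), f (ω (n₀ + (n + 1))) ∂M.law μ s ≤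
      ENNReal.ofReal c * ∫⁻ ω in E n, f (ω (n₀ + n)) ∂M.law μ s := by
    intro n
    set G : Set (Finset.Iic (n₀ + n) → V) := {h | ∀ m, n₀ ≤ m → ∀ hm : m ≤ n₀ + n,
      Preorder.frestrictLe₂ (π := fun _ => V) hm h ∈ D m} with hG
    have hGE : ∀ ω, Preorder.frestrictLe (π := fun _ => V) (n₀ + n) ω ∈ G ↔ ω ∈ E n := fun ω => Iff.rfl
    calc _ ≤ ∫⁻ ω in E n, f (ω (n₀ + (n + 1))) ∂M.law μ s :=
          lintegral_mono_set (s := E (n + 1)) fun ω (hω : ω ∈ E (n + 1)) m h₁ h₂ =>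
            hω m h₁ (by omega)
      _ = ∫⁻ ω, G.indicator (fun _ => f (ω (n₀ + n + 1))) (Preorder.frestrictLe (n₀ + n) ω)
          ∂M.law μ s := by
          rw [← lintegral_indicator (hEm n)]
          refine lintegral_congr fun ω => ?_
          by_cases h : ω ∈ E n
          · rw [Set.indicator_of_mem h, Set.indicator_of_mem ((hGE ω).2 h)]; rfl
          · rw [Set.indicator_of_notMem h, Set.indicator_of_notMem ((hGE ω).not.2 h)]
      _ = ∫⁻ ω, ∫⁻ v, G.indicator (fun _ => f v) (Preorder.frestrictLe (n₀ + n) ω)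
          ∂M.stepKernel μ (n₀ + n) (Preorder.frestrictLe (n₀ + n) ω) ∂M.law μ s :=
          M.lintegral_law_succ μ s (n₀ + n) fun h v => G.indicator (fun _ => f v) h
      _ ≤ ∫⁻ ω, (E n).indicator (fun ω => ENNReal.ofReal c * f (ω (n₀ + n))) ω ∂M.law μ s := by
          refine lintegral_mono fun ω => ?_
          by_cases h : ω ∈ E n
          · simp only [Set.indicator_of_mem h, Set.indicator_of_mem ((hGE ω).2 h)]
            obtain ⟨h₁, h₂⟩ := hD (n₀ + n) (by omega) _ (h (n₀ + n) (by omega) le_rfl)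
            exact lintegral_potential_le _ r hδ (by linarith) hK h₁ (hK _) (hδε.trans h₂)
          · simp [Set.indicator_of_notMem h, Set.indicator_of_notMem ((hGE ω).not.2 h)]
      _ = _ := by
          rw [lintegral_indicator (hEm n), lintegral_const_mul _ (hfE _)]
  have hpow : ∀ n, ∫⁻ ω in E n, f (ω (n₀ + n)) ∂M.law μ s ≤ ENNReal.ofReal c ^ n := by
    intro n
    induction n with
    | zero =>
      calc _ ≤ ∫⁻ ω in E 0, 1 ∂M.law μ s := lintegral_mono fun ω => by
            refine ENNReal.ofReal_le_one.2 ?_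
            have := pow_pos hδ (r (ω (n₀ + 0)))
            linarith
        _ ≤ _ := by simpa using prob_le_one
    | succ n ih =>
      rw [pow_succ']
      exact (hstep n).trans (by gcongr)
  have hlim : Filter.Tendsto (fun n => ENNReal.ofReal (1 / 2) * M.law μ s (E n)) Filter.atTop
      (nhds 0) := by
    refine tendsto_of_tendsto_of_tendsto_of_le_of_le tendsto_const_nhds
      (ENNReal.tendsto_pow_atTop_nhds_zero_of_lt_one (r := ENNReal.ofReal c) (by simpa using hc0))
      (fun _ => zero_le) fun n => ?_
    refine le_trans ?_ (hpow n)
    rw [← setLIntegral_const]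
    refine setLIntegral_mono (hfE _) fun ω hω => ENNReal.ofReal_le_ofReal ?_
    have h₁ := (hD (n₀ + n) (by omega) _ (hω (n₀ + n) (by omega) le_rfl)).1
    have h₂ : δ ^ r (ω (n₀ + n)) ≤ δ ^ 1 := pow_le_pow_of_le_one hδ.le (by linarith) h₁
    rw [pow_one] at h₂
    linarith
  have hle : ENNReal.ofReal (1 / 2) * M.law μ s {ω | ∀ n ≥ n₀, Preorder.frestrictLe n ω ∈ D n} ≤ 0 :=
    ge_of_tendsto' hlim fun n => by
      gcongr
      exact fun ω hω m h₁ _ => hω m h₁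
  simpa using hle

end Decay

/-! ### Ranks outside the AMECs, attractors inside them, and switched policies -/

section Strategy

variable {V A : Type*} [Finite V] [Finite A]

lemma exists_transition_lower_bound (M : MDP V A) :
    ∃ ε : ℝ≥0∞, ε ≠ 0 ∧ ∀ i a j, M.P i a j ≠ 0 → ε ≤ M.P i a j := by
  classical
  have := Fintype.ofFinite V
  have := Fintype.ofFinite A
  -- Zero probabilities are replaced by 1, which keeps the finite minimum positive.
  refine ⟨(Finset.univ : Finset (V × A × V)).inf fun p =>
    if M.P p.1 p.2.1 p.2.2 = 0 then 1 else M.P p.1 p.2.1 p.2.2, ?_, fun i a j h => ?_⟩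
  · rw [← pos_iff_ne_zero, Finset.lt_inf_iff (by simp)]
    intro p _
    split_ifs with h
    · exact one_pos
    · exact pos_iff_ne_zero.2 h
  · exact (Finset.inf_le (Finset.mem_univ (i, a, j))).trans (by simp [h])

/-- The states outside `R` and the AMECs are ranked so that every action leads to a lower rank with
positive probability. -/
lemma exists_rank_transient (M : MDP V A) (R : Finset V) :
    ∃ r : V → ℕ, ∀ i, i ∉ R → (∀ C ∈ M.amecs R, i ∉ C.1) →
      0 < r i ∧ ∀ a ∈ M.act i, ∃ j, M.P i a j ≠ 0 ∧ r j < r i := by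
  classical
  have := Fintype.ofFinite V
  have hesc : ∀ W ⊆ Finset.univ.filter fun i => i ∉ R ∧ ∀ C ∈ M.amecs R, i ∉ C.1, W.Nonempty →
      ∃ i ∈ W, ∀ a ∈ M.act i, ∃ j ∉ W, M.P i a j ≠ 0 := by
    intro W hWU hW
    -- A `W` from which no state escapes would contain an end component avoiding `R`, hence lying in
    -- an AMEC, although `W` is disjoint from all AMECs.
    by_contra! hcl
    obtain ⟨D, hD, hDW⟩ := M.exists_isEndComponent hW fun i hi => by
      obtain ⟨a, ha, h⟩ := hcl i hi
      exact ⟨a, ha, fun j hj => by_contra fun hjW => hj (h j hjW)⟩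
    have hU : ∀ i ∈ D.1, i ∉ R ∧ ∀ C ∈ M.amecs R, i ∉ C.1 := fun i hi =>
      (Finset.mem_filter.1 (hWU (hDW hi))).2
    obtain ⟨C, hC, hDC⟩ := hD.exists_mem_amecs
      (Finset.disjoint_left.2 fun i hi => (hU i hi).1)
    obtain ⟨i, hi⟩ := hD.nonempty
    exact (hU i hi).2 C hC (hDC.1 hi)
  obtain ⟨r, hr, h⟩ := exists_rank (fun i W => ∀ a ∈ M.act i, ∃ j ∉ W, M.P i a j ≠ 0)
    (fun i W W' hW h a ha => (h a ha).imp fun j hj => ⟨fun hjW => hj.1 (hW hjW), hj.2⟩)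
    (Finset.univ.filter fun i => i ∉ R ∧ ∀ C ∈ M.amecs R, i ∉ C.1) hesc
  refine ⟨r, fun i hiR hiC => ?_⟩
  have hi : i ∈ Finset.univ.filter fun i => i ∉ R ∧ ∀ C ∈ M.amecs R, i ∉ C.1 := by
    simpa using ⟨hiR, fun A B => hiC (A, B)⟩
  exact ⟨(hr i).2 hi, fun a ha => (h i hi a ha).imp fun j hj => ⟨hj.2, not_le.1 hj.1⟩⟩

/-- If `S` meets every AMEC, then the AMECs have a stationary strategy that does not leave them and
that leads, outside `S`, to lower ranks with positive probability. -/
lemma exists_attractor {V A : Type*} [Finite V] (M : MDP V A) (R S : Finset V)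
    (hS : ∀ C ∈ M.amecs R, ∃ v ∈ S, v ∈ C.1) :
    ∃ (α : V → A) (r : V → ℕ), ∀ C ∈ M.amecs R, ∀ i ∈ C.1, α i ∈ C.2 i ∧
      (i ∉ S → 0 < r i ∧ ∃ j, M.P i (α i) j ≠ 0 ∧ r j < r i) := by
  classical
  have := Fintype.ofFinite V
  have hesc : ∀ W ⊆ Finset.univ.filter fun i => i ∉ S ∧ ∃ C ∈ M.amecs R, i ∈ C.1, W.Nonempty →
      ∃ i ∈ W, ∃ C ∈ M.amecs R, i ∈ C.1 ∧ ∃ a ∈ C.2 i, ∃ j ∉ W, M.P i a j ≠ 0 := by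
    intro W hWU ⟨i, hi⟩
    obtain ⟨-, -, C, hC, hiC⟩ := Finset.mem_filter.1 (hWU hi)
    obtain ⟨v, hvS, hvC⟩ := hS C hC
    have hvW : v ∉ W := fun hv => (Finset.mem_filter.1 (hWU hv)).2.1 hvS
    -- A path inside `C` from `i ∈ W` to `v ∈ S` must leave `W`; its first step out is the required
    -- escape.
    have hpath := (maximal_of_mem_amecs hC).prop.1.connected i hiC v hvC
    induction hpath using Relation.ReflTransGen.head_induction_on with
    | refl => exact absurd hi hvW
    | head hxy _ ih =>
      rename_i x y _
      obtain ⟨a, ha, hP⟩ := hxy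
      by_cases hy : y ∈ W
      · exact ih hy ((maximal_of_mem_amecs hC).prop.1.closed x hiC a ha y hP)
      · exact ⟨x, hi, C, hC, hiC, a, ha, y, hy, hP⟩
  obtain ⟨r, hr, h⟩ := exists_rank
    (fun i W => ∃ C ∈ M.amecs R, i ∈ C.1 ∧ ∃ a ∈ C.2 i, ∃ j ∉ W, M.P i a j ≠ 0)
    (fun i W W' hW ⟨C, hC, hi, a, ha, j, hj, hP⟩ =>
      ⟨C, hC, hi, a, ha, j, fun hjW => hj (hW hjW), hP⟩)
    (Finset.univ.filter fun i => i ∉ S ∧ ∃ C ∈ M.amecs R, i ∈ C.1) hesc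
  have hα : ∀ i, ∃ a, ∀ C ∈ M.amecs R, i ∈ C.1 → a ∈ C.2 i ∧
      (i ∉ S → 0 < r i ∧ ∃ j, M.P i a j ≠ 0 ∧ r j < r i) := by
    intro i
    by_cases hi : ∃ C ∈ M.amecs R, i ∈ C.1
    · by_cases hiS : i ∈ S
      · obtain ⟨C, hC, hiC⟩ := hi
        obtain ⟨a, ha⟩ := (maximal_of_mem_amecs hC).prop.1.act_nonempty i hiC
        refine ⟨a, fun D hD hiD => ⟨?_, fun h => absurd hiS h⟩⟩
        rwa [eq_of_mem_amecs hD hC hiD hiC]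
      · have hiU : i ∈ Finset.univ.filter fun i => i ∉ S ∧ ∃ C ∈ M.amecs R, i ∈ C.1 :=
          Finset.mem_filter.2 ⟨Finset.mem_univ i, hiS, hi⟩
        obtain ⟨C, hC, hiC, a, ha, j, hj, hP⟩ := h i hiU
        refine ⟨a, fun D hD hiD => ⟨?_, fun _ => ⟨(hr i).2 hiU, j, hP, not_le.1 hj⟩⟩⟩
        rwa [eq_of_mem_amecs hD hC hiD hiC]
    · obtain ⟨a, -⟩ := M.act_nonempty i
      exact ⟨a, fun C hC hiC => absurd ⟨C, hC, hiC⟩ hi⟩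
  choose α hα using hα
  exact ⟨α, r, fun C hC i hi => hα i C hC hi⟩

open Classical in
/-- The policy that follows `μ` outside `T` and the stationary strategy `α` on `T`. -/
noncomputable def switchPolicy {V A : Type*} (M : MDP V A) (μ : M.Policy) (T : Set V) (α : V → A)
    (hα : ∀ i ∈ T, α i ∈ M.act i) : M.Policy where
  toFun n h := if h ⟨n, Finset.mem_Iic.2 le_rfl⟩ ∈ T then α (h ⟨n, Finset.mem_Iic.2 le_rfl⟩)
    else μ.toFun n h
  valid n h := by
    split_ifs with hT
    · exact hα _ hT
    · exact μ.valid n h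

/-- There is a policy. -/
lemma nonempty_policy {V A : Type*} (M : MDP V A) : Nonempty M.Policy :=
  ⟨⟨fun _ h => (M.act_nonempty (h ⟨_, Finset.mem_Iic.2 le_rfl⟩)).choose,
    fun _ h => (M.act_nonempty (h ⟨_, Finset.mem_Iic.2 le_rfl⟩)).choose_spec⟩⟩

end Strategy

/-! ### Reaching AMECs, meeting the specification, and monotonicity of the cost -/

section Reachability

variable {V A : Type*} [Finite V] [MeasurableSpace V] [DiscreteMeasurableSpace V]

/-- The states of the AMECs. -/
def accepting {V A : Type*} (M : MDP V A) (R : Finset V) : Set V := {v | ∃ C ∈ M.amecs R, v ∈ C.1}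

/-- The walks that reach an AMEC without having visited `R`. -/
def reachEvent {V A : Type*} (M : MDP V A) (R : Finset V) : Set (ℕ → V) :=
  {ω | ∃ t, (∀ r ≤ t, ω r ∉ R) ∧ ω t ∈ M.accepting R}

lemma le_stepKernel_of_transition (M : MDP V A) (μ : M.Policy) {ε : ℝ≥0∞}
    (hε : ∀ i a j, M.P i a j ≠ 0 → ε ≤ M.P i a j) (n : ℕ) (h : Finset.Iic n → V) (B : Set V)
    (hB : ∃ j, M.P (h ⟨n, Finset.mem_Iic.2 le_rfl⟩) (μ.toFun n h) j ≠ 0 ∧ j ∈ B) :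
    ε ≤ M.stepKernel μ n h B := by
  obtain ⟨j, hj, hjB⟩ := hB
  calc ε ≤ M.P (h ⟨n, Finset.mem_Iic.2 le_rfl⟩) (μ.toFun n h) j := hε _ _ _ hj
    _ = M.stepKernel μ n h {j} := (PMF.toMeasure_apply_singleton _ _ .of_discrete).symm
    _ ≤ M.stepKernel μ n h B := measure_mono (by simpa using hjB)

/-- Almost surely the walk visits `R` or an AMEC. -/
lemma ae_exists_mem [Finite A] (M : MDP V A) (R : Finset V) (μ : M.Policy) (s : V) :
    ∀ᵐ ω ∂M.law μ s, ∃ t, ω t ∈ R ∨ ω t ∈ M.accepting R := by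
  obtain ⟨ε, hε0, hε⟩ := M.exists_transition_lower_bound
  obtain ⟨r, hr⟩ := M.exists_rank_transient R
  have h := M.law_forall_mem_eq_zero μ s 0 r hε0
    (fun n => {h | h ⟨n, Finset.mem_Iic.2 le_rfl⟩ ∉ R ∧
      h ⟨n, Finset.mem_Iic.2 le_rfl⟩ ∉ M.accepting R}) (fun n _ h ⟨h₁, h₂⟩ => by
        obtain ⟨h₃, h₄⟩ := hr _ h₁ fun C hC hi => h₂ ⟨C, hC, hi⟩
        exact ⟨h₃, M.le_stepKernel_of_transition μ hε n h _ (h₄ _ (μ.valid n h))⟩)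
  filter_upwards [measure_eq_zero_iff_ae_notMem.1 h] with ω hω
  by_contra! hc
  exact hω fun n _ => hc n

lemma specProb_le_reachEvent [Finite A] (M : MDP V A) (R S : Finset V) (μ : M.Policy) (s : V) :
    M.specProb R S μ s ≤ M.law μ s (M.reachEvent R) := by
  refine measure_mono_ae ?_
  filter_upwards [M.ae_exists_mem R μ s] with ω ⟨t, ht⟩ hω
  exact ⟨t, fun r _ => hω.1 r, ht.resolve_left (hω.1 t)⟩

/-- Policies that agree outside the AMECs reach them with the same probability. -/
lemma law_reachEvent_congr (M : MDP V A) (R : Finset V) (μ μ' : M.Policy) (s : V)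
    (hμ : ∀ n h, h ⟨n, Finset.mem_Iic.2 le_rfl⟩ ∉ M.accepting R → μ.toFun n h = μ'.toFun n h) :
    M.law μ s (M.reachEvent R) = M.law μ' s (M.reachEvent R) := by
  classical
  -- The event is split by the first time an AMEC is entered; before that time the two policies
  -- agree.
  let B : ∀ n : ℕ, Set (Finset.Iic n → V) := fun n => {h | (∀ i, h i ∉ R) ∧
    h ⟨n, Finset.mem_Iic.2 le_rfl⟩ ∈ M.accepting R ∧ ∀ i, i.1 < n → h i ∉ M.accepting R}
  have hE : M.reachEvent R = ⋃ n, Preorder.frestrictLe (π := fun _ => V) n ⁻¹' B n := by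
    ext ω
    simp only [Set.mem_iUnion]
    constructor
    · rintro ⟨t, hR, ht⟩
      have hex : ∃ t, ω t ∈ M.accepting R := ⟨t, ht⟩
      refine ⟨Nat.find hex, fun i => ?_, Nat.find_spec hex, fun i hi => Nat.find_min hex hi⟩
      exact hR i ((Finset.mem_Iic.1 i.2).trans (Nat.find_min' hex ht))
    · rintro ⟨t, hR, ht, -⟩
      exact ⟨t, fun r hr => hR ⟨r, Finset.mem_Iic.2 hr⟩, ht⟩
  have hd : Pairwise (Function.onFun Disjoint
      fun n => Preorder.frestrictLe (π := fun _ => V) n ⁻¹' B n) := by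
    refine (pairwise_disjoint_on _).2 fun m n hmn => ?_
    refine Set.disjoint_left.2 fun ω hm hn => ?_
    exact hn.2.2 ⟨m, Finset.mem_Iic.2 hmn.le⟩ hmn hm.2.1
  have hm : ∀ n, MeasurableSet (Preorder.frestrictLe (π := fun _ => V) n ⁻¹' B n) := fun n =>
    measurableSet_frestrictLe_preimage n (B n)
  rw [hE, measure_iUnion hd hm, measure_iUnion hd hm]
  exact tsum_congr fun n => M.law_congr_of_agree μ μ' s (M.accepting R) hμ n (B n)
    fun h hh => hh.2.2

/-- If `S` meets every AMEC, then every policy has a modification that, almost surely, stays in an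
AMEC once there, and meets the specification if the original policy reaches an AMEC safely. -/
lemma exists_policy [Finite A] (M : MDP V A) {R S : Finset V}
    (hS : ∀ C ∈ M.amecs R, ∃ v ∈ S, v ∈ C.1) (μ : M.Policy) :
    ∃ μ' : M.Policy, ∀ s,
      (∀ᵐ ω ∂M.law μ' s, ∀ t, ∀ C ∈ M.amecs R, ω t ∈ C.1 → ω (t + 1) ∈ C.1) ∧
      M.law μ s (M.reachEvent R) ≤ M.specProb R S μ' s := by
  classical
  obtain ⟨ε, hε0, hε⟩ := M.exists_transition_lower_bound
  obtain ⟨α, r, hα⟩ := M.exists_attractor R S hS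
  set μ' := M.switchPolicy μ (M.accepting R) α fun i ⟨C, hC, hi⟩ =>
    (maximal_of_mem_amecs hC).prop.1.act_subset i hi (hα C hC i hi).1
  have hin : ∀ n h, h ⟨n, Finset.mem_Iic.2 le_rfl⟩ ∈ M.accepting R →
      μ'.toFun n h = α (h ⟨n, Finset.mem_Iic.2 le_rfl⟩) := fun n h hT => if_pos hT
  refine ⟨μ', fun s => ?_⟩
  have hstay : ∀ᵐ ω ∂M.law μ' s, ∀ t, ∀ C ∈ M.amecs R, ω t ∈ C.1 → ω (t + 1) ∈ C.1 := by
    refine ae_all_iff.2 fun t => M.ae_law_succ μ' s t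
      (fun h v => ∀ C ∈ M.amecs R, h ⟨t, Finset.mem_Iic.2 le_rfl⟩ ∈ C.1 → v ∈ C.1) ?_
    intro h v hv C hC hi
    rw [hin t h ⟨C, hC, hi⟩] at hv
    exact (maximal_of_mem_amecs hC).prop.1.closed _ hi _ (hα C hC _ hi).1 v hv
  have hvisit : ∀ᵐ ω ∂M.law μ' s, ∀ n₀, ∃ n ≥ n₀, ω n ∈ S ∨ ω n ∉ M.accepting R := by
    refine ae_all_iff.2 fun n₀ => ?_
    have h := M.law_forall_mem_eq_zero μ' s n₀ r hε0
      (fun n => {h | h ⟨n, Finset.mem_Iic.2 le_rfl⟩ ∉ S ∧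
        h ⟨n, Finset.mem_Iic.2 le_rfl⟩ ∈ M.accepting R}) (fun n _ h ⟨h₁, h₂⟩ => by
          obtain ⟨C, hC, hi⟩ := h₂
          obtain ⟨h₃, j, h₄, h₅⟩ := (hα C hC _ hi).2 h₁
          refine ⟨h₃, M.le_stepKernel_of_transition μ' hε n h _ ⟨j, ?_, h₅⟩⟩
          rwa [hin n h ⟨C, hC, hi⟩])
    filter_upwards [measure_eq_zero_iff_ae_notMem.1 h] with ω hω
    by_contra! hc
    exact hω fun n hn => hc n hn
  refine ⟨hstay, ?_⟩
  rw [M.law_reachEvent_congr R μ μ' s fun n h hT => (if_neg hT).symm]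
  refine measure_mono_ae ?_
  filter_upwards [hstay, hvisit] with ω h₁ h₂ ⟨t, hR, C, hC, ht⟩
  have hC' : ∀ n, t ≤ n → ω n ∈ C.1 := fun n hn => Nat.le_induction ht (fun n _ h => h₁ n C hC h) n hn
  refine ⟨fun n => ?_, Filter.frequently_atTop.2 fun n₀ => ?_⟩
  · rcases le_total n t with h | h
    · exact hR n h
    · exact amecs_notMem_of_mem hC (hC' n h)
  -- Past time `t` the walk stays in `C`, so the alternative of having left the AMECs is excluded.
  · obtain ⟨n, hn, hnS⟩ := h₂ (max n₀ t)
    exact ⟨n, (le_max_left _ _).trans hn,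
      hnS.resolve_right fun h => h ⟨C, hC, hC' n ((le_max_right _ _).trans hn)⟩⟩

lemma maxSpecProb_le_of_forall_exists [Finite A] (M : MDP V A) {R S : Finset V}
    (hS : ∀ C ∈ M.amecs R, ∃ v ∈ S, v ∈ C.1) (S' : Finset V) (s : V) :
    M.maxSpecProb R S' s ≤ M.maxSpecProb R S s := by
  refine iSup_le fun μ => ?_
  obtain ⟨μ', hμ'⟩ := M.exists_policy hS μ
  exact (M.specProb_le_reachEvent R S' μ s).trans ((hμ' s).2.trans
    (le_iSup (fun μ => M.specProb R S μ s) μ'))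

/-- Started inside an AMEC, the walk has already reached one safely at time 0, so the switched
policy succeeds almost surely. -/
lemma one_le_maxSpecProb [Finite A] (M : MDP V A) {R S : Finset V}
    (hS : ∀ C ∈ M.amecs R, ∃ v ∈ S, v ∈ C.1) {C : Finset V × (V → Finset A)}
    (hC : C ∈ M.amecs R) {s : V} (hs : s ∈ C.1) : 1 ≤ M.maxSpecProb R S s := by
  obtain ⟨μ⟩ := M.nonempty_policy
  obtain ⟨μ', hμ'⟩ := M.exists_policy hS μ
  calc 1 = M.law μ s Set.univ := measure_univ.symm
    _ ≤ M.law μ s (M.reachEvent R) := by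
        refine measure_mono_ae ?_
        filter_upwards [M.ae_law_zero μ s] with ω hω _
        refine ⟨0, fun r hr => ?_, ?_⟩
        · rw [Nat.le_zero.1 hr, hω]
          exact amecs_notMem_of_mem hC hs
        · rw [hω]
          exact ⟨C, hC, hs⟩
    _ ≤ M.specProb R S μ' s := (hμ' s).2
    _ ≤ _ := le_iSup (fun μ => M.specProb R S μ s) μ'

lemma maxSpecProb_mono (M : MDP V A) (R : Finset V) {S T : Finset V} (h : S ⊆ T) (s : V) :
    M.maxSpecProb R S s ≤ M.maxSpecProb R T s :=
  iSup_mono fun _ => measure_mono fun _ hω => ⟨hω.1, hω.2.mono fun _ ht => h ht⟩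

/-- A set that maximizes the reachability probability meets every AMEC. -/
lemma MaximizesReach.exists_mem [Finite A] {M : MDP V A} {R : Finset V} {k : ℕ} {S B : Finset V}
    (hS : M.MaximizesReach R k S) (hB : B.card ≤ k) (hBC : ∀ C ∈ M.amecs R, ∃ v ∈ B, v ∈ C.1)
    {C : Finset V × (V → Finset A)} (hC : C ∈ M.amecs R) : ∃ v ∈ S, v ∈ C.1 := by
  by_contra! hSC
  obtain ⟨s, hs⟩ := (maximal_of_mem_amecs hC).prop.1.nonempty
  obtain ⟨μ⟩ := M.nonempty_policy
  obtain ⟨μ', hμ'⟩ := M.exists_policy hBC μ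
  have h₁ : 1 ≤ M.reachProb R B μ' s := by
    calc 1 = M.law μ' s Set.univ := measure_univ.symm
      _ ≤ M.reachProb R B μ' s := by
        refine measure_mono_ae ?_
        filter_upwards [M.ae_law_zero μ' s] with ω hω _
        refine ⟨0, fun r hr => ?_, C, hC, ?_, hBC C hC⟩
        · rw [Nat.le_zero.1 hr, hω]
          exact amecs_notMem_of_mem hC hs
        · rwa [hω]
  -- The walk never leaves `C`, so by disjointness `C` is the only AMEC it can reach, and `S` misses
  -- it.
  have h₂ : M.reachProb R S μ' s = 0 := by
    refine measure_eq_zero_iff_ae_notMem.2 ?_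
    filter_upwards [M.ae_law_zero μ' s, (hμ' s).1] with ω h0 hstay ⟨t, hR', D, hD, ht, v, hvS, hvD⟩
    have hC' : ω t ∈ C.1 := by
      clear ht hR'
      induction t with
      | zero => rwa [h0]
      | succ t ih => exact hstay t C hC ih
    rw [eq_of_mem_amecs hD hC ht hC'] at hvD
    exact hSC v hvS hvD
  have h₃ := hS.2 B hB μ' s
  rw [h₂] at h₃
  exact absurd (h₁.trans h₃) (by simp)

lemma maximizesReach_of_forall_exists {M : MDP V A} {R : Finset V} {k : ℕ} {S : Finset V}
    (hcard : S.card ≤ k) (h : ∀ C ∈ M.amecs R, ∃ v ∈ S, v ∈ C.1) : M.MaximizesReach R k S :=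
  ⟨hcard, fun _ _ _ _ => measure_mono fun _ ⟨t, hR, C, hC, ht, _⟩ => ⟨t, hR, C, hC, ht, h C hC⟩⟩

/-- The optimal average cost per cycle is antitone in the set that completes the cycles. -/
lemma optACPC_anti {V A : Type*} [Finite V] [MeasurableSpace V] [DiscreteMeasurableSpace V]
    [DecidableEq V] (M : MDP V A) (s : V) : Antitone (M.optACPC s) := by
  intro S T h
  refine iInf_mono fun μ => Filter.limsup_le_limsup (.of_forall fun n => lintegral_mono fun ω => ?_)
  refine ENNReal.div_le_div_left ?_ _
  unfold cycleCount
  gcongr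

end Reachability

end MDP

/-! ### Assembly of the theorem -/

theorem mainTheorem7 {V A : Type*} [Fintype V] [DecidableEq V] [Fintype A]
    [MeasurableSpace V] [DiscreteMeasurableSpace V]
    (M : MDP V A) (R : Finset V) (k : ℕ) (hk : M.numAMEC R ≤ k) :
    -- the constraint of the reformulated problem is a matroid constraint
    (IsMatroidFamily (M.partitionFamily R) ∧ IsMatroidFamily (M.jointFamily R k)) ∧
    -- maximizing the reachability probability maximizes the optimal specification probability
    (∀ S, M.MaximizesReach R k S → M.MaximizesSpec R k S) ∧
    -- the converse, if no AMEC can be dispensed with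
    ((∀ C ∈ M.amecs R, ∃ s ∈ C.1, M.maxSpecProb R (Finset.univ \ C.1) s < 1) →
      ∀ S, M.MaximizesSpec R k S → M.MaximizesReach R k S) ∧
    -- feasible sets are independent, and bases are feasible
    (∀ S, M.MaximizesReach R k S → S ∈ M.jointFamily R k) ∧
    (∀ S, Maximal (fun T => T ∈ M.jointFamily R k) S → M.MaximizesReach R k S) ∧
    -- the two minimization problems are equivalent
    (∀ s : V,
      (∃ S, IsSolution {T | M.MaximizesReach R k T} (M.optACPC s) S) ∧
      (⨅ S ∈ {T | M.MaximizesReach R k T}, M.optACPC s S) =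
        (⨅ S ∈ M.jointFamily R k, M.optACPC s S) ∧
      (∀ S, IsSolution {T | M.MaximizesReach R k T} (M.optACPC s) S →
        IsSolution (M.jointFamily R k) (M.optACPC s) S) ∧
      (∀ S, IsSolution (M.jointFamily R k) (M.optACPC s) S → M.MaximizesReach R k S →
        IsSolution {T | M.MaximizesReach R k T} (M.optACPC s) S) ∧
      (∀ S, IsSolution (M.jointFamily R k) (M.optACPC s) S →
        ∃ T, S ⊆ T ∧ Maximal (fun U => U ∈ M.jointFamily R k) T ∧
          IsSolution {U | M.MaximizesReach R k U} (M.optACPC s) T)) := by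
  have hbasis : ∀ S, Maximal (fun T => T ∈ M.jointFamily R k) S → M.MaximizesReach R k S :=
    fun S hS => MDP.maximizesReach_of_forall_exists (MDP.card_le_of_mem_jointFamily hk hS.prop)
      fun C hC => MDP.exists_mem_of_maximal_jointFamily hS hC
  -- A basis serves as the competitor of size at most `k` that meets every AMEC, and as the witness
  -- that the feasible family is nonempty.
  obtain ⟨B, -, hB⟩ := MDP.exists_maximal_jointFamily (M.empty_mem_jointFamily R k)
  have hBk : B.card ≤ k := MDP.card_le_of_mem_jointFamily hk hB.prop
  have hBC : ∀ C ∈ M.amecs R, ∃ v ∈ B, v ∈ C.1 := fun C hC =>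
    MDP.exists_mem_of_maximal_jointFamily hB hC
  have hmeet : ∀ S, M.MaximizesReach R k S → ∀ C ∈ M.amecs R, ∃ v ∈ S, v ∈ C.1 :=
    fun S hS C hC => hS.exists_mem hBk hBC hC
  have hjoint : ∀ S, M.MaximizesReach R k S → S ∈ M.jointFamily R k := fun S hS =>
    MDP.mem_jointFamily_of_forall_exists hS.1 (hmeet S hS)
  have hext : ∀ S ∈ M.jointFamily R k, ∃ T, S ⊆ T ∧
      Maximal (fun U => U ∈ M.jointFamily R k) T := fun S hS => MDP.exists_maximal_jointFamily hS
  refine ⟨⟨M.isMatroidFamily_partitionFamily R, M.isMatroidFamily_unionFamily R _⟩,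
    fun S hS => ⟨hS.1, fun S' _ s => M.maxSpecProb_le_of_forall_exists (hmeet S hS) S' s⟩,
    fun hne S hS => ?_, hjoint, hbasis, fun s => ⟨?_, ?_, ?_, ?_, ?_⟩⟩
  · refine MDP.maximizesReach_of_forall_exists hS.1 fun C hC => ?_
    by_contra! h
    obtain ⟨s, hs, hlt⟩ := hne C hC
    refine absurd ?_ (not_lt.2 (M.one_le_maxSpecProb hBC hC hs))
    -- A set missing `C` lies in its complement, so its optimal probability from `s` is below 1, and
    -- optimality over `B` would bring that of `B` below 1 too.
    refine (hS.2 B hBk s).trans_lt ((M.maxSpecProb_mono R (fun v hv => ?_) s).trans_lt hlt)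
    simpa using h v hv
  · obtain ⟨S, hS, hmin⟩ := (Set.toFinite {T | M.MaximizesReach R k T}).exists_minimalFor
      (M.optACPC s) _ ⟨B, hbasis B hB⟩
    exact ⟨S, hS, fun T hT => (le_total _ _).elim id fun h => hmin hT h⟩
  · refine le_antisymm (le_iInf₂ fun S hS => ?_)
      (le_iInf₂ fun S hS => iInf₂_le S (hjoint S hS))
    obtain ⟨T, hST, hT⟩ := hext S hS
    exact (iInf₂_le T (hbasis T hT)).trans (M.optACPC_anti s hST)
  · intro S hS
    refine ⟨hjoint S hS.1, fun U hU => ?_⟩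
    obtain ⟨T, hUT, hT⟩ := hext U hU
    exact (hS.2 T (hbasis T hT)).trans (M.optACPC_anti s hUT)
  · exact fun S hS hSR => ⟨hSR, fun T hT => hS.2 T (hjoint T hT)⟩
  · intro S hS
    obtain ⟨T, hST, hT⟩ := hext S hS.1
    exact ⟨T, hST, hT, hbasis T hT, fun U hU =>
      (M.optACPC_anti s hST).trans (hS.2 U (hjoint U hU))⟩
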